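/- Let $d,N\ge 1$, let $\mathbb P^*$ be a Borel probability measure on $\mathbb R^d$, and let $\mathcal S=(\hat u_1,\dots,\hat u_N)$ be drawn i.i.d. from $\mathbb P^*$. Put $x^+=\max(x,0)$ and $\mathcal B=\{(a,b)\in\mathbb R^d\times\mathbb R:\|a\|_1+|b|\le 1\}$. Let $\Gamma_{LCX}$ and $\Gamma_\sigma$ be real thresholds, which may depend on $\mathcal S$, and let $$\Gamma(a,b)=\frac1N\sum_{j=1}^N(a^T\hat u_j-b)^++\Gamma_{LCX}.$$ The linear-convex-ordering test rejects the hypothesis $\mathbb P^*=\mathbb P_0$ if $\mathbb E^{\mathbb P_0}[(a^T\tilde u-b)^+]-\frac1N\sum_j(a^T\hat u_j-b)^+>\Gamma_{LCX}$ for some $(a,b)\in\mathcal B$, or if $\frac1N\sum_j\|\hat u_j\|_2^2-\mathbb E^{\mathbb P_0}[\|\tilde u\|_2^2]>\Gamma_\sigma$. Its confidence region is the set of Borel probability measures that are not rejected, $$\mathcal P^{LCX}=\Big\{\mathbb P:\ \mathbb E^{\mathbb P}[(a^T\tilde u-b)^+]\le\Gamma(a,b)\ \ \forall(a,b)\in\mathcal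 B,\quad \mathbb E^{\mathbb P}[\|\tilde u\|_2^2]\ge\frac1N\sum_{j=1}^N\|\hat u_j\|_2^2-\Gamma_\sigma\Big\}.$$ Let $0<\alpha<1$, and suppose that the test is valid at level $\alpha$: the probability over $\mathcal S$ that it rejects the true distribution $\mathbb P^*$ is at most $\alpha$. For $0<\epsilon<1$ let $$\mathcal U^{LCX}_\epsilon=\Big\{u\in\mathbb R^d:\ \exists r\in\mathbb R^d,\ 1\le z\le 1/\epsilon\ \text{ s.t. }\ (a^Tr-b(z-1))^++(a^Tu-b)^+\le z\,\Gamma(a,b)\ \ \forall(a,b)\in\mathcal B\Big\}.$$ (1) With probability at least $1-\alpha$ over $\mathcal S$, the family $\{\mathcal U^{LCX}_\epsilon:0<\epsilon<1\}$ simultaneously implies a probabilistic guarantee for $\mathbb P^*$: for every $0<\epsilon<1$, every $k$, every $f:\mathbb R^d\times\mathbb R^k\to\mathbb R$ such that $f(\cdot,x)$ is concave for every $x$, and every $x^*\in\mathbb R^k$, if $f(u,x^*)\le0$ for all $u\in\mathcal U^{LCX}_\epsilon$, then $\mathbb P^*(f(\tilde u,x^*)\le0)\ge1-\epsilon$. (2)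 For every sample with $\Gamma_{LCX}>0$, every $0<\epsilon<1$ and every $v\in\mathbb R^d$, the support function $\delta^*(v\mid\mathcal U^{LCX}_\epsilon)=\sup_{u\in\mathcal U^{LCX}_\epsilon}v^Tu$ satisfies $$\delta^*(v\mid\mathcal U^{LCX}_\epsilon)=\sup_{\mathbb P\in\mathcal P^{LCX}}\mathrm{VaR}^{\mathbb P}_\epsilon(v)=\min_{\tau,\theta,y_1,y_2,\lambda}\ \frac1\epsilon\tau-\theta-\int_{\mathcal B}b\,dy_1+\int_{\mathcal B}b\,dy_2,$$ where $\mathrm{VaR}^{\mathbb P}_\epsilon(v)=\inf\{t\in\mathbb R:\mathbb P(\tilde u^Tv\le t)\ge1-\epsilon\}$. The minimum is finite and attained, and runs over $\tau,\theta\ge0$ and finite Borel measures $\lambda,y_1,y_2$ on $\mathcal B$ subject to $$\theta+\int_{\mathcal B}b\,dy_1+\int_{\mathcal B}\Gamma\,d\lambda\le\tau,\quad 0\le y_1\le\lambda,\quad 0\le y_2\le\lambda,\quad \int_{\mathcal B}a\,dy_1=0,\quad \int_{\mathcal B}a\,dy_2=v.$$ -/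

import Mathlib

open MeasureTheory
open scoped ENNReal

namespace LCX

/-- The space `ℝ^d` with its Euclidean structure; `aᵀu` is `inner ℝ a u`. -/
abbrev Vec (d : ℕ) := EuclideanSpace ℝ (Fin d)

/-- The index set `{(a, b) : ‖a‖₁ + |b| ≤ 1}` in `ℝ^d × ℝ`. -/
def indexSet (d : ℕ) : Set (Vec d × ℝ) :=
  {p | ∑ i, |p.1 i| + |p.2| ≤ 1}

/-- The hinge `(aᵀu - b)⁺`. -/
noncomputable def hinge {d : ℕ} (p : Vec d × ℝ) (u : Vec d) : ℝ :=
  max (inner ℝ p.1 u - p.2) 0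

/-- The sample average `(1/N) ∑ⱼ g(ûⱼ)`. -/
noncomputable def sampleMean {d N : ℕ} (S : Fin N → Vec d) (g : Vec d → ℝ) : ℝ :=
  (1 / (N : ℝ)) * ∑ j, g (S j)

/-- The expectation, possibly `+∞`, of a nonnegative function `g`. -/
noncomputable def expect {d : ℕ} (P : Measure (Vec d)) (g : Vec d → ℝ) : EReal :=
  ((∫⁻ u, ENNReal.ofReal (g u) ∂P : ℝ≥0∞) : EReal)

/-- `Γ(a, b) = (1/N) ∑ⱼ (aᵀûⱼ - b)⁺ + Γ_LCX`. -/
noncomputable def bound {d N : ℕ} (S : Fin N → Vec d) (G : ℝ) (p : Vec d × ℝ) : ℝ :=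
  sampleMean S (hinge p) + G

/-- The linear-convex-ordering test with thresholds `G = Γ_LCX` and `Gσ = Γ_σ`, applied to the
sample `S`, rejects the null hypothesis that the sampled distribution is `P₀`. -/
def Rejects {d N : ℕ} (S : Fin N → Vec d) (G Gσ : ℝ) (P₀ : Measure (Vec d)) : Prop :=
  (∃ p ∈ indexSet d, expect P₀ (hinge p) - ((sampleMean S (hinge p) : ℝ) : EReal) > (G : EReal)) ∨
  ((sampleMean S (fun u => ‖u‖ ^ 2) : ℝ) : EReal) - expect P₀ (fun u => ‖u‖ ^ 2) > (Gσ : EReal)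

/-- The confidence region of the test: all Borel probability measures that are consistent with
the sample. -/
def confRegion {d N : ℕ} (S : Fin N → Vec d) (G Gσ : ℝ) : Set (Measure (Vec d)) :=
  {P | IsProbabilityMeasure P ∧
    (∀ p ∈ indexSet d, expect P (hinge p) ≤ ((bound S G p : ℝ) : EReal)) ∧
    ((sampleMean S (fun u => ‖u‖ ^ 2) - Gσ : ℝ) : EReal) ≤ expect P (fun u => ‖u‖ ^ 2)}

/-- The uncertainty set at level `ε`. -/
def uncertaintySet {d N : ℕ} (S : Fin N → Vec d) (G ε : ℝ) : Set (Vec d) :=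
  {u | ∃ (r : Vec d) (z : ℝ), 1 ≤ z ∧ z ≤ 1 / ε ∧
    ∀ p ∈ indexSet d,
      max (inner ℝ p.1 r - p.2 * (z - 1)) 0 + max (inner ℝ p.1 u - p.2) 0
        ≤ z * bound S G p}

/-- `U` implies a probabilistic guarantee for `P` at level `ε`. -/
def ImpliesGuarantee {d : ℕ} (P : Measure (Vec d)) (ε : ℝ) (U : Set (Vec d)) : Prop :=
  ∀ (k : ℕ) (f : Vec d → Vec k → ℝ), (∀ x, ConcaveOn ℝ Set.univ (fun u => f u x)) →
    ∀ x : Vec k, (∀ u ∈ U, f u x ≤ 0) → ENNReal.ofReal (1 - ε) ≤ P {u | f u x ≤ 0}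

/-- The family `U ε`, `0 < ε < 1`, simultaneously implies a probabilistic guarantee for `P`. -/
def SimultaneouslyImpliesGuarantee {d : ℕ} (P : Measure (Vec d)) (U : ℝ → Set (Vec d)) : Prop :=
  ∀ ε : ℝ, 0 < ε → ε < 1 → ImpliesGuarantee P ε (U ε)

/-- The support function `sup_{u ∈ U} vᵀu`. -/
noncomputable def supportFunction {d : ℕ} (U : Set (Vec d)) (v : Vec d) : EReal :=
  ⨆ u ∈ U, ((inner ℝ v u : ℝ) : EReal)

/-- The Value at Risk `inf {t : P(uᵀv ≤ t) ≥ 1 - ε}`. -/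
noncomputable def valueAtRisk {d : ℕ} (P : Measure (Vec d)) (ε : ℝ) (v : Vec d) : EReal :=
  ⨅ t ∈ {t : ℝ | ENNReal.ofReal (1 - ε) ≤ P {u | inner ℝ u v ≤ t}}, (t : EReal)

/-- Feasibility in the linear program over measures on the index set. The order on measures is
setwise, so `y₁ ≤ lam` is `dy₁ ≤ dλ`. -/
structure LPFeasible {d N : ℕ} (S : Fin N → Vec d) (G : ℝ) (v : Vec d) (τ θ : ℝ)
    (y₁ y₂ lam : Measure (indexSet d)) : Prop where
  finite : IsFiniteMeasure lam
  budget : θ + (∫ p, p.1.2 ∂y₁) + (∫ p, bound S G p.1 ∂lam) ≤ τ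
  y₁_le : y₁ ≤ lam
  y₂_le : y₂ ≤ lam
  y₁_zero : ∫ p, p.1.1 ∂y₁ = 0
  y₂_eq : v = ∫ p, p.1.1 ∂y₂
  θ_nonneg : 0 ≤ θ
  τ_nonneg : 0 ≤ τ

/-- The set of objective values of feasible solutions of the linear program. -/
def lpValues {d N : ℕ} (S : Fin N → Vec d) (G ε : ℝ) (v : Vec d) : Set ℝ :=
  {c | ∃ (τ θ : ℝ) (y₁ y₂ lam : Measure (indexSet d)), LPFeasible S G v τ θ y₁ y₂ lam ∧
    c = (1 / ε) * τ - θ - (∫ p, p.1.2 ∂y₁) + (∫ p, p.1.2 ∂y₂)}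

end LCX

/-!
The two directions of the argument are the same construction read both ways. If `P` meets the
moment bounds and `A` is an open convex event with `P A ≥ ε`, then `u = E[x | A]`,
`r = E[x; Aᶜ] / P A` and `z = 1 / P A` witness that `u` lies in the uncertainty set, because the
hinge of an average is at most the average of the hinge, separately on `A` and on `Aᶜ`
(`exists_mem_uncertaintySet`); and `u` lies in `A` by convexity. With `A = {f(·, x) > 0}` this is
the probabilistic guarantee, valid for every sample that does not reject `P`. With
`A = {vᵀu > t}` it bounds every Value at Risk by the support function.

Conversely a triple `(u, r, z)` is turned into the distribution with mass `1/z` at `u` and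
`1 - 1/z` at `r/(z - 1)`, which meets the moment bounds. The Value at Risk needs mass strictly more
than `ε` at `u`, and the confidence region a large second moment, so the triple is first mixed with
the empirical mean, which has slack `Γ_LCX > 0`; the slack then pays for a very distant atom of very
small mass (`exists_slack`, `exists_mem_confRegion`).

Weak duality for the linear program is obtained by integrating the constraints against `y₁` and
`y₂` (`inner_le_of_mem_lpValues`). For strong duality, each inequality in the finitely many
variables `(u, r, z)` is viewed as a vector. The vectors of the constraints form a compact set, and
by Slater's condition, again due to `Γ_LCX > 0`, a linear functional is positive on it. A Farkas
lemma for such sets (`exists_smul_mem_convexHull`) writes the inequality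
`vᵀu ≤ δ*(v | U)`, which holds on the uncertainty set, as a conic combination of constraints. The
coefficients of the combination are finite measures on the index set and form an optimal solution
of the linear program.
-/

namespace LCX

/-! ### Conditioning on a convex event -/

lemma continuous_hinge {d : ℕ} (p : Vec d × ℝ) : Continuous (hinge p) := by
  unfold hinge; fun_prop

lemma hinge_nonneg {d : ℕ} (p : Vec d × ℝ) (u : Vec d) : 0 ≤ hinge p u := le_max_right _ _

lemma single_mem_indexSet {d : ℕ} (i : Fin d) {c : ℝ} (hc : |c| ≤ 1) :
    ((EuclideanSpace.single i c : Vec d), (0 : ℝ)) ∈ indexSet d := by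
  have : ∑ j, |(EuclideanSpace.single i c : Vec d) j| = |c| := by
    rw [Finset.sum_eq_single i] <;> simp +contextual
  rw [indexSet, Set.mem_ofPred_eq, this]
  simpa using hc

lemma expect_eq_coe_integral {d : ℕ} {P : Measure (Vec d)} {g : Vec d → ℝ} (hg : ∀ u, 0 ≤ g u)
    (hi : Integrable g P) : expect P g = ((∫ u, g u ∂P : ℝ) : EReal) := by
  rw [expect, ← ofReal_integral_eq_lintegral_ofReal hi (Filter.Eventually.of_forall hg),
    EReal.coe_ennreal_ofReal, max_eq_left (integral_nonneg hg)]

lemma integrable_of_expect_le {d : ℕ} {P : Measure (Vec d)} {g : Vec d → ℝ} (hg : ∀ u, 0 ≤ g u)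
    (hc : Continuous g) {c : ℝ} (h : expect P g ≤ (c : EReal)) : Integrable g P := by
  refine ⟨hc.aestronglyMeasurable, ?_⟩
  rw [hasFiniteIntegral_iff_ofReal (Filter.Eventually.of_forall hg)]
  rw [lt_top_iff_ne_top]
  intro htop
  rw [expect, htop] at h
  simp at h

/-- Finite hinge moments in the coordinate directions force a finite first moment. -/
lemma integrable_id_of_expect_hinge_le {d : ℕ} {P : Measure (Vec d)} {c : Vec d × ℝ → ℝ}
    (h : ∀ p ∈ indexSet d, expect P (hinge p) ≤ (c p : EReal)) :
    Integrable (fun u : Vec d => u) P := by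
  refine Integrable.of_eval_piLp fun i => ?_
  have h1 := integrable_of_expect_le (hinge_nonneg _) (continuous_hinge _)
    (h _ (single_mem_indexSet i (c := 1) (by simp)))
  have h2 := integrable_of_expect_le (hinge_nonneg _) (continuous_hinge _)
    (h _ (single_mem_indexSet i (c := -1) (by simp)))
  refine (h1.sub h2).congr (Filter.Eventually.of_forall fun u => ?_)
  simp only [hinge, Pi.sub_apply, EuclideanSpace.inner_single_left, sub_zero]
  simp

/-- The mean of a probability distribution conditioned on an open convex event of positive
probability lies in that event. -/
lemma average_mem_of_isOpen {d : ℕ} {P : Measure (Vec d)} [IsFiniteMeasure P]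
    (hi : Integrable (fun u : Vec d => u) P) {A : Set (Vec d)} (hA : IsOpen A) (hc : Convex ℝ A)
    (hq : 0 < P.real A) : (P.real A)⁻¹ • ∫ x in A, x ∂P ∈ A := by
  by_contra hu
  obtain ⟨f, hf⟩ := geometric_hahn_banach_open_point hc hA hu
  rw [map_smul, ← f.integral_comp_comm hi.integrableOn, smul_eq_mul] at hf
  set I := ∫ x in A, f x ∂P
  have hfi : IntegrableOn (fun x => f x) A P := (f.integrable_comp hi).integrableOn
  have hpos : 0 < ∫ x in A, ((P.real A)⁻¹ * I - f x) ∂P := by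
    rw [setIntegral_pos_iff_support_of_nonneg_ae]
    · refine lt_of_lt_of_le (ENNReal.toReal_pos_iff.1 hq).1 (measure_mono fun x hx => ⟨?_, hx⟩)
      exact (sub_pos.2 (hf x hx)).ne'
    · exact (ae_restrict_mem hA.measurableSet).mono fun x hx => (sub_pos.2 (hf x hx)).le
    · exact (integrable_const _).sub hfi
  rw [integral_sub (integrable_const _) hfi, setIntegral_const, smul_eq_mul,
    mul_inv_cancel_left₀ hq.ne'] at hpos
  exact lt_irrefl _ (sub_pos.1 hpos)

/-- The key construction: conditioning a distribution that meets the moment bounds on an open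
convex event of probability at least `ε` gives a point of the uncertainty set inside the event. -/
lemma exists_mem_uncertaintySet {d N : ℕ} {S : Fin N → Vec d} {G ε : ℝ} (hε : 0 < ε)
    {P : Measure (Vec d)} [IsProbabilityMeasure P]
    (h : ∀ p ∈ indexSet d, expect P (hinge p) ≤ ((bound S G p : ℝ) : EReal))
    {A : Set (Vec d)} (hA : IsOpen A) (hc : Convex ℝ A) (hP : ε ≤ P.real A) :
    ∃ u ∈ A, u ∈ uncertaintySet S G ε := by
  have hi := integrable_id_of_expect_hinge_le h
  have hq : 0 < P.real A := hε.trans_le hP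
  set q := P.real A with hqd
  refine ⟨_, average_mem_of_isOpen hi hA hc hq, q⁻¹ • ∫ x in Aᶜ, x ∂P, q⁻¹, ?_, ?_, ?_⟩
  · exact one_le_inv₀ hq |>.2 measureReal_le_one
  · rw [one_div]; exact inv_anti₀ hε hP
  intro p hp
  have hlin : Integrable (fun x : Vec d => inner ℝ p.1 x) P := hi.const_inner p.1
  have hh : Integrable (hinge p) P :=
    integrable_of_expect_le (hinge_nonneg p) (continuous_hinge p) (h p hp)
  have hle := h p hp
  rw [expect_eq_coe_integral (hinge_nonneg p) hh, EReal.coe_le_coe_iff] at hle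
  have key : ∀ B : Set (Vec d),
      max (inner ℝ p.1 (q⁻¹ • ∫ x in B, x ∂P) - p.2 * (q⁻¹ * P.real B)) 0
        ≤ q⁻¹ * ∫ x in B, hinge p x ∂P := by
    intro B
    have hq' : 0 ≤ q⁻¹ := (inv_pos.2 hq).le
    refine max_le ?_ (mul_nonneg hq' (integral_nonneg (hinge_nonneg p)))
    have : inner ℝ p.1 (q⁻¹ • ∫ x in B, x ∂P) - p.2 * (q⁻¹ * P.real B)
        = q⁻¹ * ∫ x in B, (inner ℝ p.1 x - p.2) ∂P := by
      rw [integral_sub hlin.integrableOn (integrable_const _), setIntegral_const,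
        inner_smul_right, integral_inner hi.integrableOn, smul_eq_mul]
      ring
    rw [this]
    refine mul_le_mul_of_nonneg_left ?_ hq'
    exact integral_mono (hlin.integrableOn.sub (integrable_const _)) hh.integrableOn
      fun x => le_max_left _ _
  have k1 := key A
  have k2 := key Aᶜ
  rw [← hqd, inv_mul_cancel₀ hq.ne', mul_one] at k1
  rw [probReal_compl_eq_one_sub hA.measurableSet, ← hqd, mul_sub, inv_mul_cancel₀ hq.ne',
    mul_one] at k2
  calc _ ≤ q⁻¹ * ∫ x in Aᶜ, hinge p x ∂P + q⁻¹ * ∫ x in A, hinge p x ∂P := add_le_add k2 k1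
    _ = q⁻¹ * ∫ x, hinge p x ∂P := by
        rw [← mul_add, add_comm, integral_add_compl hA.measurableSet hh]
    _ ≤ _ := by gcongr

/-- A distribution that meets the moment bounds enjoys the probabilistic guarantee. -/
lemma impliesGuarantee_of_expect_hinge_le {d N : ℕ} {S : Fin N → Vec d} {G ε : ℝ} (hε : 0 < ε)
    {P : Measure (Vec d)} [IsProbabilityMeasure P]
    (h : ∀ p ∈ indexSet d, expect P (hinge p) ≤ ((bound S G p : ℝ) : EReal)) :
    ImpliesGuarantee P ε (uncertaintySet S G ε) := by
  intro k f hf x hU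
  have hcont : Continuous fun u => f u x :=
    continuousOn_univ.1 ((hf x).continuousOn isOpen_univ)
  have hA : IsOpen {u | 0 < f u x} := isOpen_lt continuous_const hcont
  have hc : Convex ℝ {u | 0 < f u x} := by simpa using (hf x).convex_gt 0
  by_contra hlt
  have hcompl : {u | f u x ≤ 0} = {u | 0 < f u x}ᶜ := by ext u; simp
  rw [not_le, hcompl] at hlt
  have h1 : P.real {u | 0 < f u x}ᶜ < 1 - ε :=
    (ENNReal.lt_ofReal_iff_toReal_lt (measure_ne_top _ _)).1 hlt
  rw [probReal_compl_eq_one_sub hA.measurableSet] at h1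
  obtain ⟨u, hu, huU⟩ := exists_mem_uncertaintySet hε h hA hc (by linarith)
  exact absurd (hU u huU) (not_le.2 hu)

lemma expect_hinge_le_of_not_rejects {d N : ℕ} {S : Fin N → Vec d} {G Gσ : ℝ}
    {P : Measure (Vec d)} (h : ¬ Rejects S G Gσ P) :
    ∀ p ∈ indexSet d, expect P (hinge p) ≤ ((bound S G p : ℝ) : EReal) := by
  intro p hp
  have h1 := not_lt.1 fun hlt => h (Or.inl ⟨p, hp, hlt⟩)
  rw [bound, EReal.coe_add, add_comm]
  exact (EReal.sub_le_iff_le_add (Or.inl (EReal.coe_ne_bot _)) (Or.inl (EReal.coe_ne_top _))).1 h1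

/-- No distribution in the confidence region has a Value at Risk above the support function. -/
lemma valueAtRisk_le_supportFunction {d N : ℕ} {S : Fin N → Vec d} {G Gσ ε : ℝ} (hε : 0 < ε)
    {P : Measure (Vec d)} (hP : P ∈ confRegion S G Gσ) (v : Vec d) :
    valueAtRisk P ε v ≤ supportFunction (uncertaintySet S G ε) v := by
  obtain ⟨_, hP, -⟩ := hP
  refine EReal.le_of_forall_lt_iff_le.1 fun t ht => ?_
  refine iInf₂_le t ?_
  rw [Set.mem_ofPred_eq]
  by_contra hlt
  have hA : IsOpen {u : Vec d | t < inner ℝ u v} :=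
    isOpen_lt continuous_const (by fun_prop)
  have hc : Convex ℝ {u : Vec d | t < inner ℝ u v} :=
    convex_halfSpace_gt ⟨fun x y => inner_add_left x y v, fun c x => real_inner_smul_left x v c⟩ t
  have hcompl : {u : Vec d | inner ℝ u v ≤ t} = {u : Vec d | t < inner ℝ u v}ᶜ := by ext u; simp
  rw [not_le, hcompl] at hlt
  have h1 := (ENNReal.lt_ofReal_iff_toReal_lt (measure_ne_top _ _)).1 hlt
  change P.real _ < _ at h1
  rw [probReal_compl_eq_one_sub hA.measurableSet] at h1
  obtain ⟨u, hu, huU⟩ := exists_mem_uncertaintySet hε hP hA hc (by linarith)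
  have h2 : ((inner ℝ v u : ℝ) : EReal) ≤ supportFunction (uncertaintySet S G ε) v :=
    le_iSup₂_of_le u huU le_rfl
  have h3 := h2.trans_lt ht
  rw [EReal.coe_lt_coe_iff, real_inner_comm] at h3
  exact absurd h3 (not_lt.2 (le_of_lt hu))

/-! ### Distributions built from members of the uncertainty set -/

lemma sampleMean_nonneg {d N : ℕ} (S : Fin N → Vec d) {g : Vec d → ℝ} (hg : ∀ u, 0 ≤ g u) :
    0 ≤ sampleMean S g :=
  mul_nonneg (by positivity) (Finset.sum_nonneg fun j _ => hg _)

lemma bound_pos {d N : ℕ} (S : Fin N → Vec d) {G : ℝ} (hG : 0 < G) (p : Vec d × ℝ) :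
    0 < bound S G p :=
  add_pos_of_nonneg_of_pos (sampleMean_nonneg S (hinge_nonneg p)) hG

/-- Jensen's inequality for the hinge under the empirical distribution. -/
lemma hinge_mean_le {d N : ℕ} (hN : 0 < N) (S : Fin N → Vec d) (p : Vec d × ℝ) :
    hinge p ((1 / (N : ℝ)) • ∑ j, S j) ≤ sampleMean S (hinge p) := by
  have hN' : (0 : ℝ) < N := by exact_mod_cast hN
  refine max_le ?_ (sampleMean_nonneg S (hinge_nonneg p))
  have : inner ℝ p.1 ((1 / (N : ℝ)) • ∑ j, S j) - p.2
      = sampleMean S (fun u => inner ℝ p.1 u - p.2) := by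
    rw [sampleMean, inner_smul_right, inner_sum, Finset.sum_sub_distrib, mul_sub]
    simp [hN'.ne']
  rw [this, sampleMean, sampleMean]
  gcongr
  exact le_max_left _ _

lemma sum_abs_scaled_mem_indexSet {d : ℕ} (v : Vec d) :
    ((∑ i, |v i| + 1)⁻¹ • v, (0 : ℝ)) ∈ indexSet d := by
  have h0 : 0 ≤ ∑ i, |v i| := Finset.sum_nonneg fun i _ => abs_nonneg _
  simp only [indexSet, Set.mem_ofPred_eq, PiLp.smul_apply, smul_eq_mul, abs_mul, abs_zero, add_zero,
    ← Finset.mul_sum, abs_inv, abs_of_pos (by linarith : 0 < ∑ i, |v i| + 1)]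
  rw [inv_mul_le_one₀ (by linarith)]
  linarith

lemma bddAbove_inner_uncertaintySet {d N : ℕ} (S : Fin N → Vec d) {G ε : ℝ} (hG : 0 < G)
    (v : Vec d) : ∃ C : ℝ, ∀ u ∈ uncertaintySet S G ε, inner ℝ v u ≤ C := by
  have h0 : 0 ≤ ∑ i, |v i| := Finset.sum_nonneg fun i _ => abs_nonneg _
  set K := ∑ i, |v i| + 1 with hK
  have hK0 : 0 < K := by linarith
  refine ⟨K * (1 / ε * bound S G (K⁻¹ • v, 0)), ?_⟩
  rintro u ⟨r, z, hz1, hz, h⟩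
  have h1 := h _ (sum_abs_scaled_mem_indexSet v)
  rw [← hK] at h1
  have h2 : inner ℝ (K⁻¹ • v) u ≤ 1 / ε * bound S G (K⁻¹ • v, 0) := by
    have hb := bound_pos S hG (K⁻¹ • v, 0)
    calc _ ≤ z * bound S G (K⁻¹ • v, 0) := by
          refine le_trans ?_ h1
          have := le_max_left (inner ℝ (K⁻¹ • v) u - 0) 0
          have := le_max_right (inner ℝ (K⁻¹ • v) r - 0 * (z - 1)) 0
          simp only at *
          linarith
      _ ≤ _ := by gcongr
  rw [real_inner_smul_left, inv_mul_le_iff₀ hK0] at h2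
  exact h2

/-- The empirical mean, paired with `r = 0` and `z = 1`, satisfies the constraints with slack `G`;
mixing it into a member of the uncertainty set makes the constraints strict. -/
lemma exists_slack {d N : ℕ} (hN : 0 < N) {S : Fin N → Vec d} {G ε s : ℝ} (hε1 : ε < 1)
    (hε : 0 < ε) (hs : 0 < s) (hs1 : s ≤ 1) {u : Vec d} (hu : u ∈ uncertaintySet S G ε) :
    ∃ (r : Vec d) (z : ℝ), 1 ≤ z ∧ z < 1 / ε ∧ ∀ p ∈ indexSet d,
      max (inner ℝ p.1 r - p.2 * (z - 1)) 0
        + hinge p ((1 - s) • u + s • (1 / (N : ℝ)) • ∑ j, S j) + s * G ≤ z * bound S G p := by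
  obtain ⟨r, z, hz1, hz, h⟩ := hu
  have h1ε : 1 < 1 / ε := (one_lt_div hε).2 hε1
  refine ⟨(1 - s) • r, (1 - s) * z + s, by nlinarith, by nlinarith, fun p hp => ?_⟩
  have h1 := h p hp
  have h2 := hinge_mean_le hN S p
  have h3 : max (inner ℝ p.1 ((1 - s) • r) - p.2 * ((1 - s) * z + s - 1)) 0
      = (1 - s) * max (inner ℝ p.1 r - p.2 * (z - 1)) 0 := by
    rw [mul_max_of_nonneg _ _ (by linarith), inner_smul_right, mul_zero]
    congr 1; ring
  set m := (1 / (N : ℝ)) • ∑ j, S j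
  have h4 : hinge p ((1 - s) • u + s • m) ≤ (1 - s) * hinge p u + s * hinge p m := by
    have a1 : inner ℝ p.1 u - p.2 ≤ hinge p u := le_max_left _ _
    have a2 : inner ℝ p.1 m - p.2 ≤ hinge p m := le_max_left _ _
    refine max_le ?_ ?_
    · rw [inner_add_right, inner_smul_right, inner_smul_right]
      nlinarith
    · have := hinge_nonneg p u
      have := hinge_nonneg p m
      have : 0 ≤ 1 - s := by linarith
      positivity
  rw [h3]
  change _ + hinge p u ≤ _ at h1
  have h5 := mul_le_mul_of_nonneg_left h1 (by linarith : 0 ≤ 1 - s)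
  have h6 : s * hinge p m ≤ s * sampleMean S (hinge p) := by gcongr
  have h7 : bound S G p = sampleMean S (hinge p) + G := rfl
  calc _ ≤ (1 - s) * (z * bound S G p) + s * (bound S G p - G) + s * G := by
        rw [h7] at h5 ⊢; linarith
    _ = _ := by ring

lemma expect_three_point {d : ℕ} {w₁ w₂ w₃ : ℝ} (h₁ : 0 ≤ w₁) (h₂ : 0 ≤ w₂) (h₃ : 0 ≤ w₃)
    (x₁ x₂ x₃ : Vec d) {g : Vec d → ℝ} (hg : ∀ u, 0 ≤ g u) :
    expect (ENNReal.ofReal w₁ • Measure.dirac x₁ + ENNReal.ofReal w₂ • Measure.dirac x₂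
      + ENNReal.ofReal w₃ • Measure.dirac x₃) g
      = ((w₁ * g x₁ + w₂ * g x₂ + w₃ * g x₃ : ℝ) : EReal) := by
  rw [expect, lintegral_add_measure, lintegral_add_measure, lintegral_smul_measure,
    lintegral_smul_measure, lintegral_smul_measure, lintegral_dirac, lintegral_dirac,
    lintegral_dirac, smul_eq_mul, smul_eq_mul, smul_eq_mul, ← ENNReal.ofReal_mul h₁,
    ← ENNReal.ofReal_mul h₂, ← ENNReal.ofReal_mul h₃,
    ← ENNReal.ofReal_add (mul_nonneg h₁ (hg _)) (mul_nonneg h₂ (hg _)),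
    ← ENNReal.ofReal_add _ (mul_nonneg h₃ (hg _)), EReal.coe_ennreal_ofReal, max_eq_left]
  · exact add_nonneg (add_nonneg (mul_nonneg h₁ (hg _)) (mul_nonneg h₂ (hg _)))
      (mul_nonneg h₃ (hg _))
  · exact add_nonneg (mul_nonneg h₁ (hg _)) (mul_nonneg h₂ (hg _))

lemma hinge_single_le {d : ℕ} {p : Vec d × ℝ} (hp : p ∈ indexSet d) (i : Fin d) {R : ℝ}
    (hR : 1 ≤ R) : hinge p (EuclideanSpace.single i R) ≤ R := by
  refine max_le ?_ (by linarith)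
  have h1 : |p.1 i| + |p.2| ≤ 1 :=
    le_trans (by
      gcongr
      exact Finset.single_le_sum (f := fun i => |p.1 i|) (fun j _ => abs_nonneg _)
        (Finset.mem_univ i)) hp
  rw [EuclideanSpace.inner_single_right]
  simp only [conj_trivial]
  have h2 := le_abs_self (p.1 i)
  have h3 := neg_abs_le p.2
  have h4 := abs_nonneg p.2
  nlinarith

/-- A strictly feasible triple `(u, r, z)` yields a distribution in the confidence region with an
atom of mass more than `ε` at `u`. Up to a small weight, it has mass `1/z` at `u` and the rest at
`r/(z-1)`; the slack pays for a far-away atom of small weight that makes the second moment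
large. -/
lemma exists_mem_confRegion {d N : ℕ} (hd : 0 < d) {S : Fin N → Vec d} {G Gσ ε z η : ℝ}
    {u r : Vec d} (hε : 0 < ε) (hz1 : 1 ≤ z) (hz : z < 1 / ε) (hη : 0 < η)
    (h : ∀ p ∈ indexSet d,
      max (inner ℝ p.1 r - p.2 * (z - 1)) 0 + hinge p u + η ≤ z * bound S G p) :
    ∃ P ∈ confRegion S G Gσ, ∀ v : Vec d, ((inner ℝ v u : ℝ) : EReal) ≤ valueAtRisk P ε v := by
  have hz0 : 0 < z := by linarith
  have hzε : 0 < 1 - ε * z := by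
    rw [lt_div_iff₀ hε] at hz; linarith
  set C := sampleMean S (fun u => ‖u‖ ^ 2) - Gσ with hC
  -- The far atom has weight `δ = η / (z R)`, so that it adds at most `δ R = η / z` to each hinge.
  obtain ⟨R, hR1, hRC, hRδ⟩ : ∃ R : ℝ, 1 ≤ R ∧ C ≤ η / z * R ∧ η / z < (1 - ε * z) * R := by
    refine ⟨1 + |C| / (η / z) + η / z / (1 - ε * z), ?_, ?_, ?_⟩
    · have : 0 ≤ |C| / (η / z) + η / z / (1 - ε * z) := by positivity
      linarith
    · have e : η / z * (1 + |C| / (η / z) + η / z / (1 - ε * z))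
          = η / z + |C| + η / z * (η / z / (1 - ε * z)) := by field_simp
      have : 0 ≤ η / z + η / z * (η / z / (1 - ε * z)) := by positivity
      rw [e]; linarith [le_abs_self C]
    · have e : (1 - ε * z) * (1 + |C| / (η / z) + η / z / (1 - ε * z))
          = (1 - ε * z) * (1 + |C| / (η / z)) + η / z := by
        rw [mul_add, mul_div_cancel₀ _ hzε.ne']
      have : 0 < (1 - ε * z) * (1 + |C| / (η / z)) := by positivity
      rw [e]; linarith
  have hR0 : 0 < R := by linarith
  set δ := η / z / R with hδ
  have hδ0 : 0 ≤ δ := by positivity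
  have hδR : δ * R = η / z := by rw [hδ]; field_simp
  have hδ1 : δ < 1 - ε * z := by rwa [hδ, div_lt_iff₀ hR0]
  have hεz : 0 < ε * z := by positivity
  have hδ2 : 0 ≤ 1 - δ := by linarith
  set w₁ := (1 - δ) / z with hw₁d
  set w₂ := (1 - δ) * (1 - 1 / z) with hw₂d
  have hzinv : 1 / z ≤ 1 := by rw [div_le_one hz0]; exact hz1
  have hw₁ : 0 ≤ w₁ := by positivity
  have hw₂ : 0 ≤ w₂ := mul_nonneg hδ2 (by linarith)
  have hsum : w₁ + w₂ + δ = 1 := by rw [hw₁d, hw₂d]; field_simp; ring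
  have hw₁ε : ε < w₁ := by rw [hw₁d, lt_div_iff₀ hz0]; linarith
  set y : Vec d := (z - 1)⁻¹ • r
  set x : Vec d := EuclideanSpace.single (⟨0, hd⟩ : Fin d) R with hx
  set P := ENNReal.ofReal w₁ • Measure.dirac u + ENNReal.ofReal w₂ • Measure.dirac y
      + ENNReal.ofReal δ • Measure.dirac x with hP
  refine ⟨P, ⟨⟨?_⟩, fun p hp => ?_, ?_⟩, fun v => ?_⟩
  · simp only [hP, Measure.add_apply, Measure.smul_apply, measure_univ, smul_eq_mul, mul_one]
    rw [← ENNReal.ofReal_add hw₁ hw₂, ← ENNReal.ofReal_add (add_nonneg hw₁ hw₂) hδ0, hsum,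
      ENNReal.ofReal_one]
  · rw [hP, expect_three_point hw₁ hw₂ hδ0 _ _ _ (hinge_nonneg p), EReal.coe_le_coe_iff]
    have h1 := h p hp
    have h2 : (1 - 1 / z) * hinge p y = 1 / z * ((z - 1) * hinge p y) := by
      field_simp
    -- At `z = 1` the middle atom has weight zero and only nonnegativity is left.
    have h3 : (z - 1) * hinge p y ≤ max (inner ℝ p.1 r - p.2 * (z - 1)) 0 := by
      rcases hz1.eq_or_lt with rfl | hlt
      · simp
      · have hz' : z - 1 ≠ 0 := by linarith
        rw [hinge, mul_max_of_nonneg _ _ (by linarith), mul_zero, inner_smul_right, mul_sub,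
          mul_inv_cancel_left₀ hz', mul_comm (z - 1) p.2]
    have h4 : δ * hinge p x ≤ η / z := by
      rw [← hδR]
      exact mul_le_mul_of_nonneg_left (hinge_single_le hp _ hR1) hδ0
    set T := max (inner ℝ p.1 r - p.2 * (z - 1)) 0
    have hT : 0 ≤ T + hinge p u := add_nonneg (le_max_right _ _) (hinge_nonneg p u)
    calc w₁ * hinge p u + w₂ * hinge p y + δ * hinge p x
        = (1 - δ) * (1 / z * ((z - 1) * hinge p y + hinge p u)) + δ * hinge p x := by
          rw [hw₁d, hw₂d, mul_assoc (1 - δ) (1 - 1 / z), h2]; ring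
      _ ≤ (1 - δ) * (1 / z * (T + hinge p u)) + η / z := by gcongr
      _ ≤ 1 * (1 / z * (T + hinge p u)) + η / z := by gcongr; linarith
      _ = (T + hinge p u + η) / z := by ring
      _ ≤ bound S G p := by rw [div_le_iff₀ hz0]; linarith
  · rw [hP, expect_three_point hw₁ hw₂ hδ0 _ _ _ (fun u => by positivity), EReal.coe_le_coe_iff]
    have hxn : ‖x‖ = R := by simp [hx, abs_of_pos hR0]
    have : δ * ‖x‖ ^ 2 = η / z * R := by rw [hxn, ← hδR]; ring
    have : 0 ≤ w₁ * ‖u‖ ^ 2 := by positivity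
    have : 0 ≤ w₂ * ‖y‖ ^ 2 := by positivity
    linarith
  · refine le_iInf₂ fun t ht => ?_
    rw [EReal.coe_le_coe_iff, real_inner_comm]
    by_contra hlt
    have hu : u ∉ {w : Vec d | inner ℝ w v ≤ t} := hlt
    have hms : MeasurableSet {w : Vec d | inner ℝ w v ≤ t} :=
      (isClosed_le (by fun_prop) continuous_const).measurableSet
    refine not_le.2 ?_ (show ENNReal.ofReal (1 - ε) ≤ P {w : Vec d | inner ℝ w v ≤ t} from ht)
    calc P {w : Vec d | inner ℝ w v ≤ t}
        ≤ 0 + ENNReal.ofReal w₂ * 1 + ENNReal.ofReal δ * 1 := by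
          simp only [hP, Measure.add_apply, Measure.smul_apply, smul_eq_mul]
          gcongr
          · rw [Measure.dirac_apply' _ hms]; simp [hu]
          · exact prob_le_one
          · exact prob_le_one
      _ = ENNReal.ofReal (1 - w₁) := by
          rw [zero_add, mul_one, mul_one, ← ENNReal.ofReal_add hw₂ hδ0]
          congr 1; linarith
      _ < ENNReal.ofReal (1 - ε) := by
          rw [ENNReal.ofReal_lt_ofReal_iff (by linarith)]; linarith

lemma supportFunction_le_iSup_valueAtRisk {d N : ℕ} (hd : 0 < d) (hN : 0 < N) {S : Fin N → Vec d}
    {G Gσ ε : ℝ} (hG : 0 < G) (hε : 0 < ε) (hε1 : ε < 1) (v : Vec d) :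
    supportFunction (uncertaintySet S G ε) v ≤ ⨆ P ∈ confRegion S G Gσ, valueAtRisk P ε v := by
  refine iSup₂_le fun u hu => ?_
  refine EReal.ge_of_forall_gt_iff_ge.1 fun t ht => ?_
  rw [EReal.coe_lt_coe_iff] at ht
  set m := (1 / (N : ℝ)) • ∑ j, S j
  obtain ⟨s, hs, hs1, hst⟩ : ∃ s : ℝ, 0 < s ∧ s ≤ 1 ∧ t < inner ℝ v ((1 - s) • u + s • m) := by
    have hc : Continuous fun s : ℝ => inner ℝ v ((1 - s) • u + s • m) := by fun_prop
    have h0 : ∀ᶠ s in nhds (0 : ℝ), t < inner ℝ v ((1 - s) • u + s • m) :=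
      (hc.tendsto 0).eventually_const_lt (by simpa using ht)
    obtain ⟨e, he, hb⟩ := Metric.eventually_nhds_iff.1 h0
    refine ⟨min (e / 2) 1, by positivity, min_le_right _ _, hb ?_⟩
    rw [Real.dist_0_eq_abs, abs_of_pos (by positivity)]
    exact (min_le_left _ _).trans_lt (by linarith)
  obtain ⟨r, z, hz1, hz, h⟩ := exists_slack hN hε1 hε hs hs1 hu
  obtain ⟨P, hP, hv⟩ := exists_mem_confRegion (Gσ := Gσ) hd hε hz1 hz (mul_pos hs hG) h
  exact ((EReal.coe_le_coe_iff.2 hst.le).trans (hv v)).trans (le_iSup₂_of_le P hP le_rfl)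

/-! ### A Farkas lemma for compactly generated cones -/

/-- In finite dimension the convex hull of a compact set is compact: by Carathéodory's theorem it
is a finite union of continuous images of products of a simplex with powers of the set. -/
lemma isCompact_convexHull {E : Type*} [NormedAddCommGroup E] [NormedSpace ℝ E]
    [FiniteDimensional ℝ E] {K : Set E} (hK : IsCompact K) : IsCompact (convexHull ℝ K) := by
  let Φ (n : ℕ) (q : (Fin n → ℝ) × (Fin n → E)) : E := ∑ i, q.1 i • q.2 i
  have hΦ : ∀ n, Continuous (Φ n) := fun n => by fun_prop
  have hc : ∀ n, IsCompact (Φ n '' (stdSimplex ℝ (Fin n) ×ˢ Set.univ.pi fun _ => K)) := fun n =>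
    ((isCompact_stdSimplex ℝ (Fin n)).prod (isCompact_univ_pi fun _ => hK)).image (hΦ n)
  have heq : convexHull ℝ K = ⋃ n ∈ Set.Iic (Module.finrank ℝ E + 1),
      Φ n '' (stdSimplex ℝ (Fin n) ×ˢ Set.univ.pi fun _ => K) := by
    refine Set.Subset.antisymm (fun x hx => ?_) ?_
    · obtain ⟨ι, _, z, w, hz, hind, hw, hw1, rfl⟩ := eq_pos_convex_span_of_mem_convexHull hx
      let e := Fintype.equivFin ι
      have hcard : Fintype.card ι ≤ Module.finrank ℝ E + 1 :=
        hind.card_le_finrank_succ.trans (Nat.succ_le_succ (Submodule.finrank_le _))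
      refine Set.mem_iUnion₂.2
        ⟨Fintype.card ι, hcard, ⟨(w ∘ e.symm, z ∘ e.symm), ⟨⟨?_, ?_⟩, ?_⟩, ?_⟩⟩
      · exact fun i => (hw _).le
      · rw [← hw1]; exact e.symm.sum_comp w
      · exact fun i _ => hz ⟨_, rfl⟩
      · exact e.symm.sum_comp fun i => w i • z i
    · refine Set.iUnion₂_subset fun n _ => ?_
      rintro _ ⟨⟨w, z⟩, ⟨hw, hz⟩, rfl⟩
      exact (convex_convexHull ℝ K).sum_mem (fun i _ => hw.1 i) hw.2
        fun i _ => subset_convexHull ℝ K (hz i trivial)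
  rw [heq]
  exact (Set.finite_Iic _).isCompact_biUnion fun n _ => hc n

/-- A Farkas lemma for the cone generated by a compact set `K` on which some linear functional is
positive. Positivity of `l` keeps the origin off the convex hull of `K`, so a ray that misses the
hull can be strictly separated from it. -/
lemma exists_smul_mem_convexHull {E : Type*} [NormedAddCommGroup E] [NormedSpace ℝ E]
    [FiniteDimensional ℝ E] {K : Set E} (hK : IsCompact K) (hne : K.Nonempty)
    (l : StrongDual ℝ E) (hl : ∀ k ∈ K, 0 < l k) {w : E}
    (hw : ∀ f : StrongDual ℝ E, (∀ k ∈ K, 0 < f k) → 0 ≤ f w) :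
    ∃ c : ℝ, 0 ≤ c ∧ ∃ k ∈ convexHull ℝ K, w = c • k := by
  by_cases hw0 : w = 0
  · obtain ⟨k, hk⟩ := hne
    exact ⟨0, le_rfl, k, subset_convexHull ℝ K hk, by rw [hw0, zero_smul]⟩
  by_contra hcon
  have hl' : ∀ k ∈ convexHull ℝ K, 0 < l k := fun k hk =>
    convexHull_min (s := K) (t := {k | 0 < l k}) hl
      (convex_halfSpace_gt ⟨l.map_add, l.map_smul⟩ 0) hk
  set ray : Set E := (fun s : ℝ => s • w) '' Set.Ici 0
  have hray : IsClosed ray := isClosedMap_smul_left w _ isClosed_Ici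
  have hrayc : Convex ℝ ray := (convex_Ici 0).is_linear_image
    ⟨fun x y => add_smul x y w, fun c x => by simp [smul_smul]⟩
  have hdisj : Disjoint (convexHull ℝ K) ray := by
    rw [Set.disjoint_left]
    rintro _ hk ⟨s, hs, rfl⟩
    rcases (Set.mem_Ici.1 hs).eq_or_lt with rfl | hs
    · simpa using hl' _ hk
    · exact hcon ⟨s⁻¹, (inv_pos.2 hs).le, _, hk, by rw [inv_smul_smul₀ hs.ne']⟩
  obtain ⟨f, a, b, hfa, hab, hfb⟩ := geometric_hahn_banach_compact_closed (convex_convexHull ℝ K)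
    (isCompact_convexHull hK) hrayc hray hdisj
  have hb : b < 0 := by simpa using hfb _ ⟨0, Set.self_mem_Ici, rfl⟩
  have hfw : 0 ≤ f w := by
    by_contra hneg
    rw [not_le] at hneg
    have := hfb _ ⟨b / f w, (div_pos_of_neg_of_neg hb hneg).le, rfl⟩
    rw [map_smul, smul_eq_mul, div_mul_cancel₀ _ hneg.ne] at this
    exact lt_irrefl _ this
  -- Tilting `-f` slightly makes it negative at `w` while it stays positive on `K`.
  obtain ⟨g, hg⟩ := SeparatingDual.exists_eq_one (R := ℝ) hw0
  obtain ⟨C, hC⟩ := hK.exists_bound_of_continuousOn (f := g) g.continuous.continuousOn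
  have hC0 : 0 ≤ C := (norm_nonneg _).trans (hC _ hne.some_mem)
  set δ := -a / (C + 1)
  have ha : 0 < -a := by linarith
  have hδ : 0 < δ := by positivity
  have hδC : δ * C < -a := by
    have : δ * (C + 1) = -a := div_mul_cancel₀ _ (by positivity)
    linarith
  have := hw (-f - δ • g) fun k hk => by
    have h1 := hfa k (subset_convexHull ℝ K hk)
    have h2 : g k ≤ C := (le_abs_self _).trans (hC k hk)
    have h3 := mul_le_mul_of_nonneg_left h2 hδ.le
    simp only [sub_apply, neg_apply,
      smul_apply, smul_eq_mul]
    linarith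
  simp only [sub_apply, neg_apply,
    smul_apply, smul_eq_mul, hg] at this
  linarith

/-! ### Duality for the linear program over measures -/

lemma isCompact_indexSet (d : ℕ) : IsCompact (indexSet d) := by
  refine Metric.isCompact_of_isClosed_isBounded ?_ ?_
  · exact isClosed_le (by fun_prop) continuous_const
  · refine (Metric.isBounded_closedBall (x := (0 : Vec d × ℝ)) (r := 1)).subset fun p hp => ?_
    have hp' : ∑ i, |p.1 i| + |p.2| ≤ 1 := hp
    have h0 : 0 ≤ ∑ i, |p.1 i| := Finset.sum_nonneg fun i _ => abs_nonneg _
    have h1 : ‖p.1‖ ≤ ∑ i, |p.1 i| := by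
      conv_lhs => rw [← (EuclideanSpace.basisFun (Fin d) ℝ).sum_repr p.1]
      refine (norm_sum_le _ _).trans (Finset.sum_le_sum fun i _ => ?_)
      rw [norm_smul, OrthonormalBasis.norm_eq_one, mul_one]
      simp
    rw [mem_closedBall_zero_iff, Prod.norm_def]
    refine max_le ?_ ?_
    · linarith [abs_nonneg p.2]
    · rw [Real.norm_eq_abs]; linarith

instance (d : ℕ) : CompactSpace (indexSet d) :=
  isCompact_iff_compactSpace.1 (isCompact_indexSet d)

lemma integrable_of_continuous {d : ℕ} {F : Type*} [NormedAddCommGroup F]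
    {μ : Measure (indexSet d)} [IsFiniteMeasure μ] {f : indexSet d → F} (hf : Continuous f) :
    Integrable f μ :=
  hf.integrable_of_hasCompactSupport (HasCompactSupport.of_compactSpace f)

lemma integral_inner_left {d : ℕ} (μ : Measure (indexSet d)) [IsFiniteMeasure μ] (u : Vec d) :
    ∫ p : indexSet d, inner ℝ p.1.1 u ∂μ = inner ℝ (∫ p, p.1.1 ∂μ) u := by
  rw [real_inner_comm, ← integral_inner (integrable_of_continuous (by fun_prop))]
  exact integral_congr_ae (Filter.Eventually.of_forall fun p => real_inner_comm _ _)

lemma integral_add_of_continuous {d : ℕ} {F : Type*} [NormedAddCommGroup F] [NormedSpace ℝ F]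
    {μ ν : Measure (indexSet d)} [IsFiniteMeasure μ] [IsFiniteMeasure ν] {f : indexSet d → F}
    (hf : Continuous f) : ∫ p, f p ∂(μ + ν) = ∫ p, f p ∂μ + ∫ p, f p ∂ν :=
  integral_add_measure (integrable_of_continuous hf) (integrable_of_continuous hf)

lemma continuous_bound {d N : ℕ} (S : Fin N → Vec d) (G : ℝ) : Continuous (bound S G) := by
  unfold bound sampleMean hinge; fun_prop

/-- Weak duality. Multiply the constraints at `(a, b)` by `dy₂` and `dy₁` and add: since
`y₁, y₂ ≤ λ`, the two hinges dominate the corresponding affine functions after integration. -/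
lemma inner_le_of_mem_lpValues {d N : ℕ} {S : Fin N → Vec d} {G ε c : ℝ} {u v : Vec d}
    (hu : u ∈ uncertaintySet S G ε) (hc : c ∈ lpValues S G ε v) : inner ℝ v u ≤ c := by
  obtain ⟨r, z, hz1, hz, h⟩ := hu
  obtain ⟨τ, θ, y₁, y₂, lam, ⟨_, hbud, hy₁, hy₂, hy₁0, hv, hθ, hτ⟩, rfl⟩ := hc
  have := isFiniteMeasure_of_le lam hy₁
  have := isFiniteMeasure_of_le lam hy₂
  set g₁ : indexSet d → ℝ := fun p => inner ℝ p.1.1 r - p.1.2 * (z - 1)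
  set g₂ : indexSet d → ℝ := fun p => inner ℝ p.1.1 u - p.1.2
  have hg₁ : Continuous g₁ := by fun_prop
  have hg₂ : Continuous g₂ := by fun_prop
  have hdom : ∀ (g : indexSet d → ℝ) (y : Measure (indexSet d)) [IsFiniteMeasure y],
      Continuous g → y ≤ lam → ∫ p, g p ∂y ≤ ∫ p, max (g p) 0 ∂lam := by
    intro g y _ hg hy
    calc ∫ p, g p ∂y ≤ ∫ p, max (g p) 0 ∂y :=
          integral_mono (integrable_of_continuous hg)
            (integrable_of_continuous (by fun_prop)) fun p => le_max_left _ _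
      _ ≤ _ := integral_mono_measure hy (Filter.Eventually.of_forall fun p => le_max_right _ _)
          (integrable_of_continuous (by fun_prop))
  have h₁ := hdom g₁ y₁ hg₁ hy₁
  have h₂ := hdom g₂ y₂ hg₂ hy₂
  have hsum : ∫ p, max (g₁ p) 0 ∂lam + ∫ p, max (g₂ p) 0 ∂lam
      ≤ z * ∫ p, bound S G p.1 ∂lam := by
    rw [← integral_add (integrable_of_continuous (by fun_prop))
      (integrable_of_continuous (by fun_prop)), ← integral_const_mul]
    refine integral_mono (integrable_of_continuous (by fun_prop)) (integrable_of_continuous ?_)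
      fun p => h p.1 p.2
    exact continuous_const.mul ((continuous_bound S G).comp continuous_subtype_val)
  have e₁ : ∫ p, g₁ p ∂y₁ = - (∫ p, p.1.2 ∂y₁) * (z - 1) := by
    rw [integral_sub (integrable_of_continuous (by fun_prop))
      (integrable_of_continuous (by fun_prop)), integral_mul_const]
    rw [integral_inner_left, hy₁0, inner_zero_left]; ring
  have e₂ : ∫ p, g₂ p ∂y₂ = inner ℝ v u - ∫ p, p.1.2 ∂y₂ := by
    rw [integral_sub (integrable_of_continuous (by fun_prop))
      (integrable_of_continuous (by fun_prop)), hv]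
    rw [integral_inner_left]
  have h3 := mul_le_mul_of_nonneg_left hbud (by linarith : 0 ≤ z)
  have h4 := mul_le_mul_of_nonneg_right hz hτ
  have h5 := mul_le_mul_of_nonneg_right hz1 hθ
  linarith

/-- The cone of all linear inequalities `w.1ᵀu + w.2.1ᵀr + w.2.2.1 z ≤ w.2.2.2` in the variables
`(u, r, z)` that are obtained from the constraints of the uncertainty set by integrating them
against measures. The multiplier `τ` belongs to `z ≤ 1/ε`, `θ` to `1 ≤ z`, and `κ` to `0 ≤ 1`. -/
def lpCone {d N : ℕ} (S : Fin N → Vec d) (G ε : ℝ) : Set (Vec d × Vec d × ℝ × ℝ) :=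
  {w | ∃ (τ θ κ : ℝ) (y₁ y₂ lam : Measure (indexSet d)), 0 ≤ τ ∧ 0 ≤ θ ∧ 0 ≤ κ ∧
    IsFiniteMeasure lam ∧ y₁ ≤ lam ∧ y₂ ≤ lam ∧
    w = (∫ p, p.1.1 ∂y₂, ∫ p, p.1.1 ∂y₁,
      τ - θ - (∫ p, p.1.2 ∂y₁) - ∫ p, bound S G p.1 ∂lam,
      1 / ε * τ - θ + (∫ p, p.1.2 ∂y₂) - (∫ p, p.1.2 ∂y₁) + κ)}

lemma add_mem_lpCone {d N : ℕ} {S : Fin N → Vec d} {G ε : ℝ} {w w' : Vec d × Vec d × ℝ × ℝ}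
    (hw : w ∈ lpCone S G ε) (hw' : w' ∈ lpCone S G ε) : w + w' ∈ lpCone S G ε := by
  obtain ⟨τ, θ, κ, y₁, y₂, lam, hτ, hθ, hκ, _, hy₁, hy₂, rfl⟩ := hw
  obtain ⟨τ', θ', κ', y₁', y₂', lam', hτ', hθ', hκ', _, hy₁', hy₂', rfl⟩ := hw'
  have := isFiniteMeasure_of_le lam hy₁
  have := isFiniteMeasure_of_le lam hy₂
  have := isFiniteMeasure_of_le lam' hy₁'
  have := isFiniteMeasure_of_le lam' hy₂'
  refine ⟨τ + τ', θ + θ', κ + κ', y₁ + y₁', y₂ + y₂', lam + lam', by positivity, by positivity,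
    by positivity, inferInstance, add_le_add hy₁ hy₁', add_le_add hy₂ hy₂', ?_⟩
  have hb : Continuous fun p : indexSet d => bound S G p.1 :=
    (continuous_bound S G).comp continuous_subtype_val
  have ha : Continuous fun p : indexSet d => p.1.1 := by fun_prop
  have hb' : Continuous fun p : indexSet d => p.1.2 := by fun_prop
  rw [integral_add_of_continuous hb, integral_add_of_continuous ha, integral_add_of_continuous ha,
    integral_add_of_continuous hb', integral_add_of_continuous hb']
  simp only [Prod.mk_add_mk, Prod.mk.injEq, true_and]
  constructor <;> ring

lemma smul_mem_lpCone {d N : ℕ} {S : Fin N → Vec d} {G ε c : ℝ} {w : Vec d × Vec d × ℝ × ℝ}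
    (hc : 0 ≤ c) (hw : w ∈ lpCone S G ε) : c • w ∈ lpCone S G ε := by
  obtain ⟨τ, θ, κ, y₁, y₂, lam, hτ, hθ, hκ, _, hy₁, hy₂, rfl⟩ := hw
  refine ⟨c * τ, c * θ, c * κ, ENNReal.ofReal c • y₁, ENNReal.ofReal c • y₂,
    ENNReal.ofReal c • lam, by positivity, by positivity, by positivity,
    Measure.smul_finite lam ENNReal.ofReal_ne_top, Measure.le_iff.2 fun s hs => ?_,
    Measure.le_iff.2 fun s hs => ?_, ?_⟩
  · exact mul_le_mul_right (hy₁ s) _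
  · exact mul_le_mul_right (hy₂ s) _
  · simp only [integral_smul_measure, ENNReal.toReal_ofReal hc, Prod.smul_mk, smul_eq_mul,
      Prod.mk.injEq, true_and]
    constructor <;> ring

lemma convex_lpCone {d N : ℕ} (S : Fin N → Vec d) (G ε : ℝ) : Convex ℝ (lpCone S G ε) :=
  fun _ hx _ hy _ _ ha hb _ => add_mem_lpCone (smul_mem_lpCone ha hx) (smul_mem_lpCone hb hy)

/-- The constraint of the uncertainty set at `p = (a, b)`, with the hinges replaced by `α` times
and `β` times their arguments, as a linear inequality in `(u, r, z)`. -/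
noncomputable def generator {d N : ℕ} (S : Fin N → Vec d) (G : ℝ) (q : (Vec d × ℝ) × ℝ × ℝ) :
    Vec d × Vec d × ℝ × ℝ :=
  (q.2.2 • q.1.1, q.2.1 • q.1.1, -(q.2.1 * q.1.2 + bound S G q.1), q.2.2 * q.1.2 - q.2.1 * q.1.2)

/-- The linear inequalities that generate `lpCone`: the linearized constraints for all
`0 ≤ α, β ≤ 1`, then `1 ≤ z`, `z ≤ 1/ε`, and `0 ≤ 1`. -/
def generators {d N : ℕ} (S : Fin N → Vec d) (G ε : ℝ) : Set (Vec d × Vec d × ℝ × ℝ) :=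
  generator S G '' (indexSet d ×ˢ Set.Icc 0 1 ×ˢ Set.Icc 0 1) ∪
    {(0, 0, -1, -1), (0, 0, 1, 1 / ε), (0, 0, 0, 1)}

lemma isCompact_generators {d N : ℕ} (S : Fin N → Vec d) (G ε : ℝ) :
    IsCompact (generators S G ε) := by
  refine IsCompact.union (((isCompact_indexSet d).prod (isCompact_Icc.prod isCompact_Icc)).image ?_)
    (Set.toFinite _).isCompact
  have := continuous_bound S G
  unfold generator
  fun_prop

lemma generator_mem_lpCone {d N : ℕ} (S : Fin N → Vec d) (G ε : ℝ) {p : Vec d × ℝ}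
    (hp : p ∈ indexSet d) {α β : ℝ} (hα : α ∈ Set.Icc (0 : ℝ) 1) (hβ : β ∈ Set.Icc (0 : ℝ) 1) :
    generator S G (p, α, β) ∈ lpCone S G ε := by
  set ν : Measure (indexSet d) := Measure.dirac ⟨p, hp⟩ with hν
  have hle : ∀ γ ∈ Set.Icc (0 : ℝ) 1, ENNReal.ofReal γ • ν ≤ ν := by
    intro γ hγ
    refine Measure.le_iff.2 fun s hs => ?_
    rw [Measure.smul_apply, smul_eq_mul]
    exact (mul_le_mul_left (ENNReal.ofReal_le_one.2 hγ.2) _).trans_eq (one_mul _)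
  refine ⟨0, 0, 0, ENNReal.ofReal α • ν, ENNReal.ofReal β • ν, ν, le_rfl, le_rfl, le_rfl,
    inferInstance, hle α hα, hle β hβ, ?_⟩
  have e : ∀ {F : Type} [NormedAddCommGroup F] [NormedSpace ℝ F] [CompleteSpace F]
      (f : indexSet d → F), ∫ q, f q ∂ν = f ⟨p, hp⟩ := fun f => integral_dirac f _
  simp only [integral_smul_measure, ENNReal.toReal_ofReal hα.1, ENNReal.toReal_ofReal hβ.1, e,
    generator, smul_eq_mul, Prod.mk.injEq, true_and]
  constructor <;> ring

lemma generators_subset_lpCone {d N : ℕ} (S : Fin N → Vec d) (G ε : ℝ) :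
    generators S G ε ⊆ lpCone S G ε := by
  rintro w (⟨⟨p, α, β⟩, hq, rfl⟩ | hw)
  · exact generator_mem_lpCone S G ε hq.1 hq.2.1 hq.2.2
  · rcases hw with rfl | rfl | rfl
    · exact ⟨0, 1, 0, 0, 0, 0, by simp [isFiniteMeasureZero]⟩
    · exact ⟨1, 0, 0, 0, 0, 0, by simp [isFiniteMeasureZero]⟩
    · exact ⟨0, 0, 1, 0, 0, 0, by simp [isFiniteMeasureZero]⟩

/-- The functional `w ↦ w.2.2.2 - (w.1ᵀu + w.2.1ᵀr + w.2.2.1 z)`. -/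
noncomputable def slackFunctional {d : ℕ} (u r : Vec d) (z : ℝ) :
    StrongDual ℝ (Vec d × Vec d × ℝ × ℝ) :=
  LinearMap.toContinuousLinearMap
    { toFun := fun w => w.2.2.2 - (inner ℝ w.1 u + inner ℝ w.2.1 r + w.2.2.1 * z)
      map_add' := fun w w' => by simp only [Prod.fst_add, Prod.snd_add, inner_add_left]; ring
      map_smul' := fun c w => by
        simp only [Prod.smul_fst, Prod.smul_snd, real_inner_smul_left, smul_eq_mul,
          RingHom.id_apply]
        ring }

lemma slackFunctional_apply {d : ℕ} (u r : Vec d) (z : ℝ) (w : Vec d × Vec d × ℝ × ℝ) :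
    slackFunctional u r z w
      = w.2.2.2 - (inner ℝ w.1 u + inner ℝ w.2.1 r + w.2.2.1 * z) := rfl

/-- A functional that is positive on the generators is, after division by its value `t` at the
trivial inequality `0 ≤ 1`, the slack functional of a triple `(u, r, z)` that satisfies all the
constraints. The conclusion keeps only its values at the inequalities `vᵀu ≤ h`. -/
lemma exists_mem_uncertaintySet_of_pos {d N : ℕ} {S : Fin N → Vec d} {G ε : ℝ}
    {f : StrongDual ℝ (Vec d × Vec d × ℝ × ℝ)} (hf : ∀ k ∈ generators S G ε, 0 < f k) :
    ∃ u ∈ uncertaintySet S G ε, ∃ t : ℝ, 0 < t ∧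
      ∀ (v : Vec d) (h : ℝ), f (v, 0, 0, h) = t * (h - inner ℝ v u) := by
  have ht : 0 < f (0, 0, 0, 1) := hf _ (Or.inr (by simp))
  set t := f (0, 0, 0, 1)
  let fu : StrongDual ℝ (Vec d) := f.comp (ContinuousLinearMap.inl ℝ _ _)
  let fr : StrongDual ℝ (Vec d) :=
    f.comp ((ContinuousLinearMap.inr ℝ _ _).comp (ContinuousLinearMap.inl ℝ _ _))
  set u' := (InnerProductSpace.toDual ℝ (Vec d)).symm fu
  set r' := (InnerProductSpace.toDual ℝ (Vec d)).symm fr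
  set z' := f (0, 0, 1, 0)
  have hrep : ∀ (a b : Vec d) (c h : ℝ),
      f (a, b, c, h) = inner ℝ a u' + inner ℝ b r' + c * z' + h * t := by
    intro a b c h
    have h1 : inner ℝ a u' = f (a, 0, 0, 0) := by
      rw [real_inner_comm, InnerProductSpace.toDual_symm_apply]; rfl
    have h2 : inner ℝ b r' = f (0, b, 0, 0) := by
      rw [real_inner_comm, InnerProductSpace.toDual_symm_apply]; rfl
    rw [h1, h2, ← smul_eq_mul, ← smul_eq_mul, ← map_smul, ← map_smul, ← map_add, ← map_add,
      ← map_add]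
    simp
  have hz1 := hf (0, 0, -1, -1) (Or.inr (by simp))
  have hz2 := hf (0, 0, 1, 1 / ε) (Or.inr (by simp))
  rw [hrep] at hz1 hz2
  simp only [inner_zero_left] at hz1 hz2
  refine ⟨-(t⁻¹ • u'), ⟨-(t⁻¹ • r'), -(t⁻¹ * z'), ?_, ?_, fun p hp => ?_⟩, t, ht, fun v h => ?_⟩
  · have : t⁻¹ * (t + z') ≤ 0 := mul_nonpos_of_nonneg_of_nonpos (by positivity) (by linarith)
    rw [mul_add, inv_mul_cancel₀ ht.ne'] at this
    linarith
  · have : 0 ≤ t⁻¹ * (z' + 1 / ε * t) := mul_nonneg (by positivity) (by linarith)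
    rw [mul_add, mul_comm (1 / ε), inv_mul_cancel_left₀ ht.ne'] at this
    linarith
  · have key : ∀ α ∈ ({0, 1} : Set ℝ), ∀ β ∈ ({0, 1} : Set ℝ),
        α * (inner ℝ p.1 (-(t⁻¹ • r')) - p.2 * (-(t⁻¹ * z') - 1))
          + β * (inner ℝ p.1 (-(t⁻¹ • u')) - p.2) ≤ -(t⁻¹ * z') * bound S G p := by
      intro α hα β hβ
      have h01 : ∀ γ ∈ ({0, 1} : Set ℝ), γ ∈ Set.Icc (0 : ℝ) 1 := by
        rintro γ (rfl | rfl) <;> simp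
      have h1 := hf _ (Or.inl ⟨(p, α, β), ⟨hp, h01 α hα, h01 β hβ⟩, rfl⟩)
      rw [generator, hrep, real_inner_smul_left, real_inner_smul_left] at h1
      have h2 := mul_nonneg (inv_pos.2 ht).le h1.le
      have h3 : t⁻¹ * ((β * p.2 - α * p.2) * t) = β * p.2 - α * p.2 := by field_simp
      simp only [mul_add] at h2
      rw [h3] at h2
      simp only [inner_neg_right, real_inner_smul_right]
      linarith
    have k00 := key 0 (by simp) 0 (by simp)
    have k01 := key 0 (by simp) 1 (by simp)
    have k10 := key 1 (by simp) 0 (by simp)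
    have k11 := key 1 (by simp) 1 (by simp)
    rw [max_add, add_max, add_max]
    refine max_le (max_le ?_ ?_) (max_le ?_ ?_) <;> linarith
  · rw [hrep, inner_neg_right, real_inner_smul_right, inner_zero_left]
    field_simp
    ring

/-- Slater's condition: the functional of `(m, (z - 1) m, z)`, with `m` the empirical mean and
`1 < z < 1/ε`, is positive on the generators. -/
lemma exists_slackFunctional_pos {d N : ℕ} (hN : 0 < N) (S : Fin N → Vec d) {G ε : ℝ} (hG : 0 < G)
    (hε : 0 < ε) (hε1 : ε < 1) :
    ∃ (u r : Vec d) (z : ℝ), ∀ k ∈ generators S G ε, 0 < slackFunctional u r z k := by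
  obtain ⟨z, hz1, hz⟩ := exists_between ((one_lt_div hε).2 hε1)
  set m := (1 / (N : ℝ)) • ∑ j, S j
  refine ⟨m, (z - 1) • m, z, ?_⟩
  rintro w (⟨⟨p, α, β⟩, ⟨hp, hα, hβ⟩, rfl⟩ | rfl | rfl | rfl)
  · have h1 := hinge_mean_le hN S p
    have h2 : inner ℝ p.1 m - p.2 ≤ hinge p m := le_max_left _ _
    have h0 := hinge_nonneg p m
    have h3 : ∀ γ ∈ Set.Icc (0 : ℝ) 1, γ * (inner ℝ p.1 m - p.2) ≤ hinge p m := fun γ hγ =>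
      (mul_le_mul_of_nonneg_left h2 hγ.1).trans (mul_le_of_le_one_left h0 hγ.2)
    have h4 := mul_le_mul_of_nonneg_left (h3 α hα) (by linarith : 0 ≤ z - 1)
    have h5 := h3 β hβ
    have h6 : z * hinge p m < z * bound S G p := by
      have : hinge p m < bound S G p := by rw [bound]; linarith
      gcongr
    rw [slackFunctional_apply]
    simp only [generator, real_inner_smul_left, real_inner_smul_right]
    linarith
  · rw [slackFunctional_apply]; simp; linarith
  · rw [slackFunctional_apply]; simp; simpa using hz
  · rw [slackFunctional_apply]; simp

/-- Strong duality with attainment: an upper bound for `vᵀu` on the uncertainty set is certified by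
a feasible solution of the linear program. -/
lemma mem_lpValues_of_forall_inner_le {d N : ℕ} (hN : 0 < N) {S : Fin N → Vec d} {G ε M : ℝ}
    (hG : 0 < G) (hε : 0 < ε) (hε1 : ε < 1) {v : Vec d}
    (hM : ∀ u ∈ uncertaintySet S G ε, inner ℝ v u ≤ M) : M ∈ lpValues S G ε v := by
  obtain ⟨u₀, r₀, z₀, hl⟩ := exists_slackFunctional_pos hN S hG hε hε1
  obtain ⟨c, hc, k, hk, hck⟩ := exists_smul_mem_convexHull (w := (v, 0, 0, M))
    (isCompact_generators S G ε) ⟨_, Or.inr (Or.inl rfl)⟩ _ hl fun f hf => by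
      obtain ⟨u, hu, t, ht, hft⟩ := exists_mem_uncertaintySet_of_pos hf
      rw [hft]
      exact mul_nonneg ht.le (sub_nonneg.2 (hM u hu))
  have hmem : (v, 0, 0, M) ∈ lpCone S G ε := by
    rw [hck]
    exact smul_mem_lpCone hc
      (convexHull_min (generators_subset_lpCone S G ε) (convex_lpCone S G ε) hk)
  obtain ⟨τ, θ, κ, y₁, y₂, lam, hτ, hθ, hκ, hfin, hy₁, hy₂, heq⟩ := hmem
  simp only [Prod.mk.injEq] at heq
  obtain ⟨e1, e2, e3, e4⟩ := heq
  -- The surplus `κ` in the objective is absorbed by raising `τ`.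
  have hεκ : 0 ≤ ε * κ := by positivity
  refine ⟨τ + ε * κ, θ, y₁, y₂, lam,
    ⟨hfin, by linarith, hy₁, hy₂, e2.symm, e1, hθ, by linarith⟩, ?_⟩
  have : 1 / ε * (ε * κ) = κ := by field_simp
  rw [mul_add, this]
  linarith

lemma uncertaintySet_nonempty {d N : ℕ} (hN : 0 < N) (S : Fin N → Vec d) {G ε : ℝ} (hG : 0 < G)
    (hε : 0 < ε) (hε1 : ε < 1) : (uncertaintySet S G ε).Nonempty := by
  refine ⟨(1 / (N : ℝ)) • ∑ j, S j, 0, 1, le_rfl, ((one_lt_div hε).2 hε1).le, fun p _ => ?_⟩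
  have : hinge p ((1 / (N : ℝ)) • ∑ j, S j) ≤ bound S G p := by
    rw [bound]; linarith [hinge_mean_le hN S p]
  simpa [hinge] using this

lemma exists_isLeast_lpValues {d N : ℕ} (hN : 0 < N) (S : Fin N → Vec d) {G ε : ℝ} (hG : 0 < G)
    (hε : 0 < ε) (hε1 : ε < 1) (v : Vec d) :
    ∃ m : ℝ, IsLeast (lpValues S G ε v) m ∧
      supportFunction (uncertaintySet S G ε) v = (m : EReal) := by
  set I := (fun u => inner ℝ v u) '' uncertaintySet S G ε with hI
  obtain ⟨C, hC⟩ := bddAbove_inner_uncertaintySet S (ε := ε) hG v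
  have hlub : IsLUB I (sSup I) := isLUB_csSup ((uncertaintySet_nonempty hN S hG hε hε1).image _)
    ⟨C, Set.forall_mem_image.2 hC⟩
  refine ⟨sSup I, ⟨?_, fun c hc => ?_⟩, le_antisymm ?_ ?_⟩
  · exact mem_lpValues_of_forall_inner_le hN hG hε hε1 fun u hu => hlub.1 ⟨u, hu, rfl⟩
  · exact hlub.2 (Set.forall_mem_image.2 fun u hu => inner_le_of_mem_lpValues hu hc)
  · exact iSup₂_le fun u hu => EReal.coe_le_coe_iff.2 (hlub.1 ⟨u, hu, rfl⟩)
  · refine EReal.ge_of_forall_gt_iff_ge.1 fun t ht => ?_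
    obtain ⟨_, ⟨u, hu, rfl⟩, htu⟩ := exists_lt_of_lt_csSup hlub.nonempty
      (EReal.coe_lt_coe_iff.1 ht)
    exact le_iSup₂_of_le u hu (EReal.coe_le_coe_iff.2 htu.le)

end LCX

theorem theorem8 (d N : ℕ) (hd : 0 < d) (hN : 0 < N)
    (Pstar : Measure (LCX.Vec d)) [IsProbabilityMeasure Pstar]
    (ΓLCX Γσ : (Fin N → LCX.Vec d) → ℝ) (α : ℝ) (hα0 : 0 < α) (hα1 : α < 1)
    (hvalid : Measure.pi (fun _ : Fin N => Pstar)
      {S | LCX.Rejects S (ΓLCX S) (Γσ S) Pstar} ≤ ENNReal.ofReal α) :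
    (Measure.pi (fun _ : Fin N => Pstar)
      {S | ¬ LCX.SimultaneouslyImpliesGuarantee Pstar
        (fun ε => LCX.uncertaintySet S (ΓLCX S) ε)} ≤ ENNReal.ofReal α) ∧
    (∀ S : Fin N → LCX.Vec d, 0 < ΓLCX S → ∀ ε : ℝ, 0 < ε → ε < 1 → ∀ v : LCX.Vec d,
      LCX.supportFunction (LCX.uncertaintySet S (ΓLCX S) ε) v
          = ⨆ P ∈ LCX.confRegion S (ΓLCX S) (Γσ S), LCX.valueAtRisk P ε v ∧
      ∃ m : ℝ, IsLeast (LCX.lpValues S (ΓLCX S) ε v) m ∧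
        LCX.supportFunction (LCX.uncertaintySet S (ΓLCX S) ε) v = (m : EReal)) := by
  refine ⟨(measure_mono fun S hS => ?_).trans hvalid, fun S hG ε hε hε1 v => ⟨?_, ?_⟩⟩
  · by_contra hrej
    exact hS fun ε hε _ => LCX.impliesGuarantee_of_expect_hinge_le hε
      (LCX.expect_hinge_le_of_not_rejects hrej)
  · exact le_antisymm (LCX.supportFunction_le_iSup_valueAtRisk hd hN hG hε hε1 v)
      (iSup₂_le fun P hP => LCX.valueAtRisk_le_supportFunction hε hP v)
  · exact LCX.exists_isLeast_lpValues hN S hG hε hε1 v
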